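/- Let $p\in[1,\infty)$. A metric space $(X,d_X)$ is a \emph{$p$-metric space} if $d_X(x,z)\le \big(d_X(x,y)^p+d_X(y,z)^p\big)^{1/p}$ for all $x,y,z\in X$. Let $\mathcal{M}_p$ be the set of isometry classes of (nonempty) compact $p$-metric spaces, equipped with the $p$-Gromov–Hausdorff distance $$d_{\mathrm{GH}}^{(p)}(X,Y)=2^{-1/p}\,\inf_R\ \sup_{(x,y),(x',y')\in R}\big|d_X(x,x')^p-d_Y(y,y')^p\big|^{1/p},$$ where $R$ ranges over all correspondences between $X$ and $Y$, i.e. subsets of $X\times Y$ whose projections to $X$ and to $Y$ are surjective; this is a $p$-metric on $\mathcal{M}_p$. For $q\in[1,\infty)$, a \emph{$q$-geodesic} in a metric space $(Z,d)$ is a continuous curve $\gamma:[0,1]\to Z$ with $d(\gamma(s),\gamma(t))=|s-t|^{1/q}\,d(\gamma(0),\gamma(1))$ for all $s,t\in[0,1]$, and $Z$ is \emph{$q$-geodesic} if any two points of $Z$ are the endpoints $\gamma(0),\gamma(1)$ of some $q$-geodesic $\gamma$; \emph{geodesic} means $1$-geodesic. \textbf{Theorem.} For every $p\in[1,\infty)$,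 the space $(\mathcal{M}_p,d_{\mathrm{GH}}^{(p)})$ is $p$-geodesic, but it is not $q$-geodesic for any $1\le q<p$. In particular, $(\mathcal{M}_p,d_{\mathrm{GH}}^{(p)})$ is not geodesic when $p>1$. -/

import Mathlib

open scoped ENNReal
open Topology

noncomputable section

namespace PGromovHausdorff

universe u v w

/-- The `p`-sum `(a ^ p + b ^ p) ^ (1 / p)` of nonnegative numbers. -/
def pSum (p a b : ℝ) : ℝ := (a ^ p + b ^ p) ^ (1 / p)

/-- The absolute `p`-difference `|a ^ p - b ^ p| ^ (1 / p)` of nonnegative numbers. -/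
def pDiff (p a b : ℝ) : ℝ := |a ^ p - b ^ p| ^ (1 / p)

/-- A metric space is a `p`-metric space if it satisfies the `p`-triangle inequality. -/
def IsPMetricSpace (p : ℝ) (X : Type u) [MetricSpace X] : Prop :=
  ∀ x y z : X, dist x z ≤ pSum p (dist x y) (dist y z)

/-- A correspondence between `X` and `Y`: a subset of `X × Y` with full projections. -/
def IsCorrespondence {X : Type u} {Y : Type v} (R : Set (X × Y)) : Prop :=
  Prod.fst '' R = Set.univ ∧ Prod.snd '' R = Set.univ

/-- The `p`-distortion of a subset of `X × Y` (possibly infinite for unbounded spaces). -/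
def pDistortion (p : ℝ) {X : Type u} {Y : Type v} [MetricSpace X] [MetricSpace Y]
    (R : Set (X × Y)) : ℝ≥0∞ :=
  ⨆ a ∈ R, ⨆ b ∈ R, ENNReal.ofReal (pDiff p (dist a.1 b.1) (dist a.2 b.2))

/-- The `p`-Gromov-Hausdorff distance `2 ^ (-1 / p) * inf_R dis_p R`, where `R` runs over all
correspondences. -/
def pGHDist (p : ℝ) (X : Type u) (Y : Type v) [MetricSpace X] [MetricSpace Y] : ℝ≥0∞ :=
  ENNReal.ofReal ((2 : ℝ) ^ (-(1 / p))) *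
    ⨅ (R : Set (X × Y)) (_ : IsCorrespondence R), pDistortion p R

/-- The set of isometry classes of (nonempty) compact `p`-metric spaces. Mathlib's
`GromovHausdorff.GHSpace` is used only as the type of isometry classes of nonempty compact metric
spaces; its metric is not used. -/
structure CompactPMetricClass (p : ℝ) : Type where
  /-- the isometry class -/
  cls : GromovHausdorff.GHSpace
  /-- its members are `p`-metric spaces -/
  isPMetricSpace : IsPMetricSpace p cls.Rep

section Facts

variable {X : Type u} {Y : Type v} {Z : Type w} [MetricSpace X] [MetricSpace Y] [MetricSpace Z]

theorem le_pDistortion {p : ℝ} {R : Set (X × Y)} {a b : X × Y} (ha : a ∈ R) (hb : b ∈ R) :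
    ENNReal.ofReal (pDiff p (dist a.1 b.1) (dist a.2 b.2)) ≤ pDistortion p R := by
  unfold pDistortion
  refine le_trans ?_ (le_iSup₂ a ha)
  exact le_iSup₂ (f := fun (b : X × Y) (_ : b ∈ R) =>
    ENNReal.ofReal (pDiff p (dist a.1 b.1) (dist a.2 b.2))) b hb

theorem pGHDist_le {p : ℝ} (hp : 1 ≤ p) {c : ℝ} (hc : 0 ≤ c) {R : Set (X × Y)}
    (hR : IsCorrespondence R)
    (h : ∀ a ∈ R, ∀ b ∈ R, |dist a.1 b.1 ^ p - dist a.2 b.2 ^ p| ≤ 2 * c ^ p) :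
    pGHDist p X Y ≤ ENNReal.ofReal c := by
  have hp0 : 0 < p := by linarith
  have h1 : pDistortion p R ≤ ENNReal.ofReal ((2 : ℝ) ^ (1 / p) * c) := by
    refine iSup₂_le fun a ha => iSup₂_le fun b hb => ENNReal.ofReal_le_ofReal ?_
    calc pDiff p (dist a.1 b.1) (dist a.2 b.2) ≤ (2 * c ^ p) ^ (1 / p) :=
          Real.rpow_le_rpow (abs_nonneg _) (h a ha b hb) (by positivity)
      _ = (2 : ℝ) ^ (1 / p) * c := by
          rw [Real.mul_rpow (by norm_num) (by positivity), ← Real.rpow_mul hc,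
            mul_one_div_cancel hp0.ne', Real.rpow_one]
  calc pGHDist p X Y
      ≤ ENNReal.ofReal ((2 : ℝ) ^ (-(1 / p))) * ENNReal.ofReal ((2 : ℝ) ^ (1 / p) * c) := by
        unfold pGHDist
        gcongr
        exact (iInf₂_le R hR).trans h1
    _ = ENNReal.ofReal c := by
        rw [← ENNReal.ofReal_mul (by positivity), ← mul_assoc, ← Real.rpow_add (by norm_num)]
        simp

theorem exists_of_pGHDist_lt {p : ℝ} (hp : 1 ≤ p) {c : ℝ} (hc : 0 ≤ c)
    (h : pGHDist p X Y < ENNReal.ofReal c) :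
    ∃ R : Set (X × Y), IsCorrespondence R ∧
      ∀ a ∈ R, ∀ b ∈ R, |dist a.1 b.1 ^ p - dist a.2 b.2 ^ p| ≤ 2 * c ^ p := by
  have hp0 : 0 < p := by linarith
  have h1 : (⨅ (R : Set (X × Y)) (_ : IsCorrespondence R), pDistortion p R)
      < ENNReal.ofReal ((2 : ℝ) ^ (1 / p) * c) := by
    by_contra hcon
    rw [not_lt] at hcon
    refine absurd h (not_lt.2 ?_)
    calc ENNReal.ofReal c
        = ENNReal.ofReal ((2 : ℝ) ^ (-(1 / p))) * ENNReal.ofReal ((2 : ℝ) ^ (1 / p) * c) := by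
          rw [← ENNReal.ofReal_mul (by positivity), ← mul_assoc, ← Real.rpow_add (by norm_num)]
          simp
      _ ≤ pGHDist p X Y := by
          unfold pGHDist
          gcongr
  simp only [iInf_lt_iff] at h1
  obtain ⟨R, hR, hlt⟩ := h1
  refine ⟨R, hR, fun a ha b hb => ?_⟩
  have h2 : ENNReal.ofReal (pDiff p (dist a.1 b.1) (dist a.2 b.2))
      ≤ ENNReal.ofReal ((2 : ℝ) ^ (1 / p) * c) :=
    le_trans (le_pDistortion ha hb) hlt.le
  rw [ENNReal.ofReal_le_ofReal_iff (by positivity)] at h2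
  have h3 := Real.rpow_le_rpow (by unfold pDiff; positivity) h2 hp0.le
  rw [pDiff, ← Real.rpow_mul (abs_nonneg _), one_div_mul_cancel hp0.ne', Real.rpow_one,
    Real.mul_rpow (by positivity) hc, ← Real.rpow_mul (by norm_num),
    one_div_mul_cancel hp0.ne', Real.rpow_one] at h3
  exact h3

theorem pGHDist_self {p : ℝ} (hp : 1 ≤ p) : pGHDist p X X = 0 := by
  have h := pGHDist_le (X := X) (Y := X) hp le_rfl (R := {a | a.1 = a.2})
    ⟨Set.eq_univ_of_forall fun x => ⟨(x, x), rfl, rfl⟩,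
      Set.eq_univ_of_forall fun x => ⟨(x, x), rfl, rfl⟩⟩
    (fun a ha b hb => by
      rw [show a.1 = a.2 from ha, show b.1 = b.2 from hb]
      simp [Real.zero_rpow (show p ≠ 0 by linarith)])
  simpa using h

theorem pGHDist_comm_le {p : ℝ} : pGHDist p X Y ≤ pGHDist p Y X := by
  unfold pGHDist
  gcongr
  refine le_iInf₂ fun R hR => ?_
  refine (iInf₂_le (Prod.swap '' R) (show IsCorrespondence (Prod.swap '' R) from
    ⟨by rw [← hR.2, Set.image_image]; rfl, by rw [← hR.1, Set.image_image]; rfl⟩)).trans ?_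
  refine iSup₂_le fun a ha => iSup₂_le fun b hb => ?_
  obtain ⟨a', ha', rfl⟩ := ha
  obtain ⟨b', hb', rfl⟩ := hb
  refine le_trans (le_of_eq ?_) (le_pDistortion ha' hb')
  simp [pDiff, abs_sub_comm]

theorem pGHDist_comm {p : ℝ} : pGHDist p X Y = pGHDist p Y X :=
  le_antisymm pGHDist_comm_le pGHDist_comm_le

theorem pGHDist_ne_top {p : ℝ} (hp : 1 ≤ p) [CompactSpace X] [CompactSpace Y] [Nonempty X]
    [Nonempty Y] : pGHDist p X Y ≠ ⊤ := by
  obtain ⟨x0⟩ := ‹Nonempty X›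
  obtain ⟨y0⟩ := ‹Nonempty Y›
  set C := max (Metric.diam (Set.univ : Set X)) (Metric.diam (Set.univ : Set Y)) with hC
  have hC0 : 0 ≤ C := le_max_of_le_left Metric.diam_nonneg
  refine ne_top_of_le_ne_top ENNReal.ofReal_ne_top
    (pGHDist_le (X := X) (Y := Y) hp hC0 (R := Set.univ)
      ⟨Set.eq_univ_of_forall fun x => ⟨(x, y0), trivial, rfl⟩,
        Set.eq_univ_of_forall fun y => ⟨(x0, y), trivial, rfl⟩⟩ ?_)
  intro a _ b _
  have h1 : dist a.1 b.1 ^ p ≤ C ^ p :=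
    Real.rpow_le_rpow dist_nonneg ((Metric.dist_le_diam_of_mem
      isCompact_univ.isBounded trivial trivial).trans (le_max_left _ _)) (by linarith)
  have h2 : dist a.2 b.2 ^ p ≤ C ^ p :=
    Real.rpow_le_rpow dist_nonneg ((Metric.dist_le_diam_of_mem
      isCompact_univ.isBounded trivial trivial).trans (le_max_right _ _)) (by linarith)
  have h3 : 0 ≤ dist a.1 b.1 ^ p := by positivity
  have h4 : 0 ≤ dist a.2 b.2 ^ p := by positivity
  rw [abs_le]
  constructor <;> linarith

theorem pGHDist_triangle {p : ℝ} (hp : 1 ≤ p) (hXY : pGHDist p X Y ≠ ⊤)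
    (hYZ : pGHDist p Y Z ≠ ⊤) :
    (pGHDist p X Z).toReal ≤ pSum p (pGHDist p X Y).toReal (pGHDist p Y Z).toReal := by
  have hp0 : 0 < p := by linarith
  set a := (pGHDist p X Y).toReal with ha
  set b := (pGHDist p Y Z).toReal with hb
  have ha0 : 0 ≤ a := ENNReal.toReal_nonneg
  have hb0 : 0 ≤ b := ENNReal.toReal_nonneg
  have key : ∀ ε : ℝ, 0 < ε → (pGHDist p X Z).toReal ≤ pSum p (a + ε) (b + ε) := by
    intro ε hε
    obtain ⟨R, hR, hRd⟩ := exists_of_pGHDist_lt (X := X) (Y := Y) hp (c := a + ε) (by positivity)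
      ((ENNReal.lt_ofReal_iff_toReal_lt hXY).2 (by linarith))
    obtain ⟨S, hS, hSd⟩ := exists_of_pGHDist_lt (X := Y) (Y := Z) hp (c := b + ε) (by positivity)
      ((ENNReal.lt_ofReal_iff_toReal_lt hYZ).2 (by linarith))
    have h0 : 0 ≤ pSum p (a + ε) (b + ε) := by unfold pSum; positivity
    refine ENNReal.toReal_le_of_le_ofReal h0 (pGHDist_le (X := X) (Y := Z) hp h0
      (R := {c | ∃ y, (c.1, y) ∈ R ∧ (y, c.2) ∈ S}) ⟨?_, ?_⟩ ?_)
    · refine Set.eq_univ_of_forall fun x => ?_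
      obtain ⟨⟨x', y⟩, hxy, rfl⟩ := hR.1.symm ▸ Set.mem_univ x
      obtain ⟨⟨y', z⟩, hyz, hy⟩ := hS.1.symm ▸ Set.mem_univ y
      obtain rfl : y' = y := hy
      exact ⟨(x', z), ⟨y', hxy, hyz⟩, rfl⟩
    · refine Set.eq_univ_of_forall fun z => ?_
      obtain ⟨⟨y, z'⟩, hyz, rfl⟩ := hS.2.symm ▸ Set.mem_univ z
      obtain ⟨⟨x, y'⟩, hxy, hy⟩ := hR.2.symm ▸ Set.mem_univ y
      obtain rfl : y' = y := hy
      exact ⟨(x, z'), ⟨y', hxy, hyz⟩, rfl⟩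
    · rintro ⟨x, z⟩ ⟨y, hxy, hyz⟩ ⟨x', z'⟩ ⟨y', hxy', hyz'⟩
      have h1 := hRd _ hxy _ hxy'
      have h2 := hSd _ hyz _ hyz'
      have h3 : pSum p (a + ε) (b + ε) ^ p = (a + ε) ^ p + (b + ε) ^ p := by
        rw [pSum, ← Real.rpow_mul (by positivity), one_div_mul_cancel hp0.ne', Real.rpow_one]
      rw [h3]
      have h4 := abs_sub_le (dist x x' ^ p) (dist y y' ^ p) (dist z z' ^ p)
      simp only at h1 h2 ⊢
      linarith
  have hcont : ContinuousAt (fun ε : ℝ => pSum p (a + ε) (b + ε)) 0 := by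
    unfold pSum
    refine ContinuousAt.rpow_const (ContinuousAt.add ?_ ?_) (Or.inr (by positivity))
    · exact ContinuousAt.rpow_const (by fun_prop) (Or.inr hp0.le)
    · exact ContinuousAt.rpow_const (by fun_prop) (Or.inr hp0.le)
  have hlim : Filter.Tendsto (fun ε : ℝ => pSum p (a + ε) (b + ε)) (𝓝[>] 0) (𝓝 (pSum p a b)) := by
    simpa using hcont.tendsto.mono_left (nhdsWithin_le_nhds (s := Set.Ioi (0 : ℝ)))
  exact ge_of_tendsto hlim (Filter.eventually_of_mem self_mem_nhdsWithin key)

theorem pSum_le_add {p : ℝ} (hp : 1 ≤ p) {a b : ℝ} (ha : 0 ≤ a) (hb : 0 ≤ b) :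
    pSum p a b ≤ a + b :=
  Real.rpow_add_rpow_le_add ha hb hp

theorem abs_sub_le_of_rpow {p : ℝ} (hp : 1 ≤ p) {a b c : ℝ} (ha : 0 ≤ a) (hb : 0 ≤ b)
    (hc : 0 ≤ c) (h : |a ^ p - b ^ p| ≤ 2 * c ^ p) : |a - b| ≤ 2 * c := by
  have hp0 : 0 < p := by linarith
  wlog hab : b ≤ a generalizing a b
  · rw [abs_sub_comm]
    exact this hb ha (by rwa [abs_sub_comm]) (le_of_not_ge hab)
  rw [abs_of_nonneg (sub_nonneg.2 hab)]
  rw [abs_of_nonneg (sub_nonneg.2 (Real.rpow_le_rpow hb hab hp0.le))] at h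
  have h1 : (a - b) ^ p + b ^ p ≤ a ^ p := by
    simpa using Real.add_rpow_le_rpow_add (sub_nonneg.2 hab) hb hp
  have h2 : (2 : ℝ) * c ^ p ≤ (2 * c) ^ p := by
    rw [Real.mul_rpow (by norm_num) hc]
    gcongr
    calc (2 : ℝ) = 2 ^ (1 : ℝ) := by simp
      _ ≤ 2 ^ p := Real.rpow_le_rpow_of_exponent_le (by norm_num) hp
  exact (Real.rpow_le_rpow_iff (sub_nonneg.2 hab) (by positivity) hp0).1 (by linarith)

theorem ghDist_eq_zero_of_pGHDist {p : ℝ} (hp : 1 ≤ p) [CompactSpace X] [CompactSpace Y]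
    [Nonempty X] [Nonempty Y] (h : pGHDist p X Y = 0) : GromovHausdorff.ghDist X Y = 0 := by
  refine le_antisymm (le_of_forall_pos_le_add fun ε hε => ?_) dist_nonneg
  obtain ⟨R, hR, hRd⟩ := exists_of_pGHDist_lt (X := X) (Y := Y) hp (c := ε / 3) (by positivity)
    (by rw [h]; simpa using hε)
  have hsel : ∀ x : X, ∃ y, (x, y) ∈ R := by
    intro x
    obtain ⟨⟨x', y⟩, hxy, rfl⟩ := hR.1.symm ▸ Set.mem_univ x
    exact ⟨y, hxy⟩
  choose f hf using hsel
  have hd : ∀ a ∈ R, ∀ b ∈ R, |dist a.1 b.1 - dist a.2 b.2| ≤ 2 * (ε / 3) := fun a ha b hb =>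
    abs_sub_le_of_rpow hp dist_nonneg dist_nonneg (by positivity) (hRd a ha b hb)
  have := GromovHausdorff.ghDist_le_of_approx_subsets (X := X) (Y := Y) (s := Set.univ)
    (fun x => f x) (ε₁ := 0) (ε₂ := 2 * (ε / 3)) (ε₃ := 2 * (ε / 3))
    (fun x => ⟨x, trivial, by simp⟩)
    (fun y => by
      obtain ⟨⟨x, y'⟩, hxy, rfl⟩ := hR.2.symm ▸ Set.mem_univ y
      refine ⟨⟨x, trivial⟩, ?_⟩
      simpa using hd _ hxy _ (hf x))
    (fun x x' => hd _ (hf x) _ (hf x'))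
  linarith

end Facts

/-- The metric of `(𝓜_p, d_GH^(p))`: the distance between two isometry classes is the
`p`-Gromov-Hausdorff distance between representatives. -/
instance CompactPMetricClass.instMetricSpace (p : ℝ) [hp : Fact (1 ≤ p)] :
    MetricSpace (CompactPMetricClass p) where
  dist A B := (pGHDist p A.cls.Rep B.cls.Rep).toReal
  dist_self A := by rw [pGHDist_self hp.out]; rfl
  dist_comm A B := by rw [pGHDist_comm]
  dist_triangle A B C :=
    (pGHDist_triangle hp.out (pGHDist_ne_top hp.out) (pGHDist_ne_top hp.out)).trans
      (pSum_le_add hp.out ENNReal.toReal_nonneg ENNReal.toReal_nonneg)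
  eq_of_dist_eq_zero := by
    intro A B h
    have h0 : pGHDist p A.cls.Rep B.cls.Rep = 0 :=
      ((ENNReal.toReal_eq_zero_iff _).1 h).resolve_right (pGHDist_ne_top hp.out)
    have h1 : A.cls = B.cls := by
      rw [← dist_eq_zero, GromovHausdorff.dist_ghDist]
      exact ghDist_eq_zero_of_pGHDist hp.out h0
    cases A
    cases B
    cases h1
    rfl

/-- `(𝓜_p, d_GH^(p))` is itself a `p`-metric space. -/
theorem CompactPMetricClass.isPMetricSpace_self (p : ℝ) [hp : Fact (1 ≤ p)] :
    IsPMetricSpace p (CompactPMetricClass p) := fun _ _ _ =>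
  pGHDist_triangle hp.out (pGHDist_ne_top hp.out) (pGHDist_ne_top hp.out)

/-- A `p`-geodesic: a continuous curve `γ` on `[0, 1]` with
`d(γ(s), γ(t)) = |s - t| ^ (1 / p) * d(γ(0), γ(1))` for all `s`, `t`. -/
structure IsPGeodesic (p : ℝ) {X : Type u} [MetricSpace X] (γ : unitInterval → X) : Prop where
  continuous : Continuous γ
  dist_eq : ∀ s t : unitInterval,
    dist (γ s) (γ t) = |(s : ℝ) - (t : ℝ)| ^ (1 / p) * dist (γ 0) (γ 1)

/-- A metric space is `p`-geodesic if any two points are connected by a `p`-geodesic. -/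
def IsPGeodesicSpace (p : ℝ) (X : Type u) [MetricSpace X] : Prop :=
  ∀ x y : X, ∃ γ : unitInterval → X, IsPGeodesic p γ ∧ γ 0 = x ∧ γ 1 = y

/-- A metric space is geodesic if any two points are connected by a constant speed minimizing
geodesic. -/
def IsGeodesicSpace (X : Type u) [MetricSpace X] : Prop :=
  ∀ x y : X, ∃ γ : unitInterval → X, Continuous γ ∧ γ 0 = x ∧ γ 1 = y ∧
    ∀ s t : unitInterval, dist (γ s) (γ t) = |(s : ℝ) - (t : ℝ)| * dist (γ 0) (γ 1)

end PGromovHausdorff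

end

open Filter

namespace PGromovHausdorff

/-! Raising distances to the power `p` turns `p`-metrics into ordinary metrics, and the bound on a
correspondence becomes linear in these powers.

Existence: by compactness some closed correspondence `R` between `A` and `B` is optimal
(`exists_isClosed_optimal`). On the compact set `R`, the kernel `(1 - t) * d_A ^ p + t * d_B ^ p`
satisfies the triangle inequality, so its `p`-th root defines, after a quotient, a compact
`p`-metric space (`exists_class_of_kernel`). Kernels at times `s` and `t` differ by `|s - t|` times
the distortion of `R`, which bounds the distance along the curve from above; the `p`-triangle
inequality in the space of classes forces equality (`isPGeodesic_of_dist_le`).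

Non-existence: for `q < p` the midpoint of a nonconstant `q`-geodesic violates the `p`-triangle
inequality (`eq_of_isPGeodesic`), and there are two distinct classes to join. -/

theorem pSum_rpow {p a b : ℝ} (hp : 1 ≤ p) (ha : 0 ≤ a) (hb : 0 ≤ b) :
    pSum p a b ^ p = a ^ p + b ^ p := by
  rw [pSum, ← Real.rpow_mul (by positivity), one_div_mul_cancel (by linarith), Real.rpow_one]

/-- In a `p`-metric space the `p`-th power of the distance satisfies the triangle inequality. -/
theorem IsPMetricSpace.rpow_dist_triangle {p : ℝ} (hp : 1 ≤ p) {X : Type*} [MetricSpace X]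
    (h : IsPMetricSpace p X) (x y z : X) : dist x z ^ p ≤ dist x y ^ p + dist y z ^ p := by
  rw [← pSum_rpow hp dist_nonneg dist_nonneg]
  exact Real.rpow_le_rpow dist_nonneg (h x y z) (by linarith)

theorem IsPMetricSpace.of_isometryEquiv {p : ℝ} {X Y : Type*} [MetricSpace X] [MetricSpace Y]
    (h : IsPMetricSpace p X) (e : X ≃ᵢ Y) : IsPMetricSpace p Y := by
  intro x y z
  simpa only [e.symm.dist_eq] using h (e.symm x) (e.symm y) (e.symm z)

/-! ### Realizing kernels as compact `p`-metric spaces -/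

theorem exists_class_isometryEquiv {p : ℝ} {X : Type*} [MetricSpace X] [CompactSpace X]
    [Nonempty X] (h : IsPMetricSpace p X) :
    ∃ A : CompactPMetricClass p, Nonempty (X ≃ᵢ A.cls.Rep) := by
  have he : Nonempty (X ≃ᵢ (GromovHausdorff.toGHSpace X).Rep) := by
    rw [← GromovHausdorff.toGHSpace_eq_toGHSpace_iff_isometryEquiv,
      GromovHausdorff.GHSpace.toGHSpace_rep]
  exact ⟨⟨GromovHausdorff.toGHSpace X, h.of_isometryEquiv he.some⟩, he⟩

/-- A compact pseudometric space satisfying the `p`-triangle inequality maps onto a compact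
`p`-metric space by a distance preserving map. -/
theorem exists_class_of_pseudoMetric {p : ℝ} {Z : Type*} [PseudoMetricSpace Z] [CompactSpace Z]
    [Nonempty Z] (h : ∀ x y z : Z, dist x z ≤ pSum p (dist x y) (dist y z)) :
    ∃ (A : CompactPMetricClass p) (φ : Z → A.cls.Rep), Function.Surjective φ ∧
      ∀ z w, dist (φ z) (φ w) = dist z w := by
  have hq : IsPMetricSpace p (SeparationQuotient Z) := by
    intro x y z
    obtain ⟨x, rfl⟩ := SeparationQuotient.surjective_mk x
    obtain ⟨y, rfl⟩ := SeparationQuotient.surjective_mk y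
    obtain ⟨z, rfl⟩ := SeparationQuotient.surjective_mk z
    simpa only [SeparationQuotient.dist_mk] using h x y z
  have : CompactSpace (SeparationQuotient Z) :=
    SeparationQuotient.surjective_mk.compactSpace SeparationQuotient.continuous_mk
  obtain ⟨A, ⟨e⟩⟩ := exists_class_isometryEquiv hq
  refine ⟨A, e ∘ SeparationQuotient.mk,
    e.surjective.comp SeparationQuotient.surjective_mk, fun z w => ?_⟩
  simp [e.dist_eq, SeparationQuotient.dist_mk]

/-- Continuity of `e` at `z` only needs `dist (e w) (e z)` to tend to zero as `w` tends to `z`. Used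
with `e = id`, to pass compactness from a given topology to that of a pseudometric. -/
theorem compactSpace_of_continuous_dist {Z W : Type*} [TopologicalSpace Z] [CompactSpace Z]
    [PseudoMetricSpace W] {e : Z → W} (he : Function.Surjective e)
    (hc : ∀ z, Continuous fun w => dist (e w) (e z)) : CompactSpace W := by
  have hcont : Continuous e := by
    refine continuous_iff_continuousAt.2 fun z => tendsto_iff_dist_tendsto_zero.2 ?_
    simpa using (hc z).tendsto z
  exact ⟨by simpa [he.range_eq] using isCompact_range hcont⟩

/-- A continuous kernel on a compact space with the properties of a pseudodistance is the `p`-th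
power of the distance of a compact `p`-metric space. -/
theorem exists_class_of_kernel {p : ℝ} (hp : 1 ≤ p) {Z : Type*} [TopologicalSpace Z]
    [CompactSpace Z] [Nonempty Z] (f : Z → Z → ℝ) (hf : ∀ z, Continuous fun w => f w z)
    (h0 : ∀ z w, 0 ≤ f z w) (hself : ∀ z, f z z = 0) (hcomm : ∀ z w, f z w = f w z)
    (htri : ∀ x y z, f x z ≤ f x y + f y z) :
    ∃ (A : CompactPMetricClass p) (φ : Z → A.cls.Rep), Function.Surjective φ ∧
      ∀ z w, dist (φ z) (φ w) ^ p = f z w := by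
  have hp0 : 0 < p := by linarith
  have hpow : ∀ z w, (f z w ^ (1 / p)) ^ p = f z w := fun z w => by
    rw [← Real.rpow_mul (h0 z w), one_div_mul_cancel hp0.ne', Real.rpow_one]
  have hptri : ∀ x y z, f x z ^ (1 / p) ≤ pSum p (f x y ^ (1 / p)) (f y z ^ (1 / p)) := by
    intro x y z
    rw [pSum, hpow, hpow]
    exact Real.rpow_le_rpow (h0 x z) (htri x y z) (by positivity)
  let m : PseudoMetricSpace Z :=
    { dist := fun z w => f z w ^ (1 / p)
      dist_self := fun z => by
        rw [hself, Real.zero_rpow (by positivity)]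
      dist_comm := fun z w => by rw [hcomm]
      dist_triangle := fun x y z => (hptri x y z).trans
        (pSum_le_add hp (Real.rpow_nonneg (h0 x y) _) (Real.rpow_nonneg (h0 y z) _)) }
  -- The topology of `m` may be coarser than the given one, so the identity carries compactness
  -- over.
  have hcompact : @CompactSpace Z m.toUniformSpace.toTopologicalSpace :=
    @compactSpace_of_continuous_dist Z Z _ _ m id Function.surjective_id
      fun z => (hf z).rpow_const fun _ => Or.inr (by positivity)
  obtain ⟨A, φ, hφ, hd⟩ := @exists_class_of_pseudoMetric p Z m hcompact _ hptri
  exact ⟨A, φ, hφ, fun z w => by rw [hd]; exact hpow z w⟩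

/-! ### Optimal correspondences -/

theorem _root_.Ultrafilter.exists_tendsto {ι W : Type*} [TopologicalSpace W] [CompactSpace W]
    (U : Ultrafilter ι) (u : ι → W) : ∃ w, Tendsto u U (𝓝 w) := by
  obtain ⟨w, -, hw⟩ := isCompact_univ.ultrafilter_le_nhds (U.map u) (by simp)
  exact ⟨w, hw⟩

/-- Between compact spaces the infimum in the `p`-Gromov-Hausdorff distance is attained by a
closed correspondence. -/
theorem exists_isClosed_optimal {p : ℝ} (hp : 1 ≤ p) {X Y : Type*} [MetricSpace X]
    [MetricSpace Y] [CompactSpace X] [CompactSpace Y] [Nonempty X] [Nonempty Y] :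
    ∃ R : Set (X × Y), IsCorrespondence R ∧ IsClosed R ∧
      ∀ a ∈ R, ∀ b ∈ R, |dist a.1 b.1 ^ p - dist a.2 b.2 ^ p|
        ≤ 2 * (pGHDist p X Y).toReal ^ p := by
  have hp0 : 0 ≤ p := by linarith
  set D := (pGHDist p X Y).toReal
  have hD : 0 ≤ D := ENNReal.toReal_nonneg
  have happrox : ∀ n : ℕ, ∃ R : Set (X × Y), IsCorrespondence R ∧
      ∀ a ∈ R, ∀ b ∈ R, |dist a.1 b.1 ^ p - dist a.2 b.2 ^ p|
        ≤ 2 * (D + 1 / ((n : ℝ) + 1)) ^ p := fun n =>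
    exists_of_pGHDist_lt hp (by positivity)
      ((ENNReal.lt_ofReal_iff_toReal_lt (pGHDist_ne_top hp)).2
        (lt_add_of_pos_right _ (by positivity)))
  choose R hR hRd using happrox
  let U : Ultrafilter ℕ := hyperfilter ℕ
  have hU : (U : Filter ℕ) ≤ atTop := Nat.hyperfilter_le_atTop
  -- Ultralimits of points of the near-optimal `R n`: one ultrafilter gives all limits at once, with
  -- no choice of subsequences.
  let S : Set (X × Y) := {a | ∃ u : ℕ → X × Y, (∀ n, u n ∈ R n) ∧ Tendsto u U (𝓝 a)}
  have hdist : Continuous fun c : (X × Y) × (X × Y) =>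
      |dist c.1.1 c.2.1 ^ p - dist c.1.2 c.2.2 ^ p| :=
    (((by fun_prop : Continuous fun c : (X × Y) × (X × Y) => dist c.1.1 c.2.1).rpow_const
      fun _ => Or.inr hp0).sub
      ((by fun_prop : Continuous fun c : (X × Y) × (X × Y) => dist c.1.2 c.2.2).rpow_const
      fun _ => Or.inr hp0)).abs
  have hc : Tendsto (fun n : ℕ => 2 * (D + 1 / ((n : ℝ) + 1)) ^ p) atTop (𝓝 (2 * D ^ p)) := by
    have h := (tendsto_one_div_add_atTop_nhds_zero_nat (𝕜 := ℝ)).const_add D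
    rw [add_zero] at h
    exact (h.rpow_const (Or.inr hp0)).const_mul 2
  have hSd : ∀ c ∈ S ×ˢ S, |dist c.1.1 c.2.1 ^ p - dist c.1.2 c.2.2 ^ p| ≤ 2 * D ^ p := by
    rintro ⟨a, b⟩ ⟨⟨u, hu, hua⟩, ⟨v, hv, hvb⟩⟩
    exact le_of_tendsto_of_tendsto' ((hdist.tendsto (a, b)).comp (hua.prodMk_nhds hvb))
      (hc.mono_left hU) fun n => hRd n _ (hu n) _ (hv n)
  -- Taking the closure costs nothing: the distortion bound is a closed condition, and full
  -- projections persist in a larger set.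
  refine ⟨closure S, ⟨?_, ?_⟩, isClosed_closure, fun a ha b hb => ?_⟩
  · refine Set.eq_univ_of_forall fun x => ?_
    have hx : ∀ n, ∃ y, (x, y) ∈ R n := fun n => by
      obtain ⟨⟨x', y⟩, hxy, rfl⟩ := (hR n).1.symm ▸ Set.mem_univ x
      exact ⟨y, hxy⟩
    choose u hu using hx
    obtain ⟨y, hy⟩ := U.exists_tendsto u
    exact ⟨(x, y), subset_closure ⟨fun n => (x, u n), hu, tendsto_const_nhds.prodMk_nhds hy⟩, rfl⟩
  · refine Set.eq_univ_of_forall fun y => ?_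
    have hy : ∀ n, ∃ x, (x, y) ∈ R n := fun n => by
      obtain ⟨⟨x, y'⟩, hxy, rfl⟩ := (hR n).2.symm ▸ Set.mem_univ y
      exact ⟨x, hxy⟩
    choose u hu using hy
    obtain ⟨x, hx⟩ := U.exists_tendsto u
    exact ⟨(x, y), subset_closure ⟨fun n => (u n, y), hu, hx.prodMk_nhds tendsto_const_nhds⟩, rfl⟩
  · have hcl : IsClosed {c : (X × Y) × (X × Y) |
        |dist c.1.1 c.2.1 ^ p - dist c.1.2 c.2.2 ^ p| ≤ 2 * D ^ p} :=
      isClosed_le hdist continuous_const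
    exact closure_minimal hSd hcl (by rw [closure_prod_eq]; exact ⟨ha, hb⟩ : (a, b) ∈ _)

/-- Two compact `p`-metric spaces parametrized by the same set are close if their distances
are. -/
theorem dist_le_of_surjective {p : ℝ} [hp : Fact (1 ≤ p)] {A B : CompactPMetricClass p}
    {Z : Type*} {φ : Z → A.cls.Rep} {ψ : Z → B.cls.Rep} (hφ : Function.Surjective φ)
    (hψ : Function.Surjective ψ) {c : ℝ} (hc : 0 ≤ c)
    (h : ∀ z w, |dist (φ z) (φ w) ^ p - dist (ψ z) (ψ w) ^ p| ≤ 2 * c ^ p) : dist A B ≤ c := by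
  refine ENNReal.toReal_le_of_le_ofReal hc (pGHDist_le hp.out hc
    (R := Set.range fun z => (φ z, ψ z)) ⟨?_, ?_⟩ ?_)
  · rw [← Set.range_comp]
    exact hφ.range_eq
  · rw [← Set.range_comp]
    exact hψ.range_eq
  · rintro _ ⟨z, rfl⟩ _ ⟨w, rfl⟩
    exact h z w

/-! ### Construction of `p`-geodesics -/

/-- A curve through points `x` and `y` of a `p`-metric space that is no longer than a
`p`-geodesic is a `p`-geodesic. -/
theorem IsPMetricSpace.isPGeodesic_of_dist_le {p : ℝ} (hp : 1 ≤ p) {X : Type*} [MetricSpace X]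
    (hX : IsPMetricSpace p X) {γ : unitInterval → X}
    (h : ∀ s t, dist (γ s) (γ t) ≤ |(s : ℝ) - t| ^ (1 / p) * dist (γ 0) (γ 1)) :
    IsPGeodesic p γ := by
  have hp0 : 0 < p := by linarith
  set D := dist (γ 0) (γ 1)
  have hD : 0 ≤ D := dist_nonneg
  have hpow : ∀ s t : unitInterval,
      (|(s : ℝ) - t| ^ (1 / p) * D) ^ p = |(s : ℝ) - t| * D ^ p := fun s t => by
    rw [Real.mul_rpow (by positivity) hD, ← Real.rpow_mul (abs_nonneg _),
      one_div_mul_cancel hp0.ne', Real.rpow_one]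
  have hle : ∀ s t, dist (γ s) (γ t) ^ p ≤ |(s : ℝ) - t| * D ^ p := fun s t => by
    rw [← hpow]
    exact Real.rpow_le_rpow dist_nonneg (h s t) hp0.le
  -- In `D ^ p ≤ d(0,s) ^ p + d(s,t) ^ p + d(t,1) ^ p` the outer terms are at most `s * D ^ p` and
  -- `(1 - t) * D ^ p`, which leaves `(t - s) * D ^ p` for the middle one.
  have hge : ∀ s t : unitInterval, s ≤ t →
      |(s : ℝ) - t| ^ (1 / p) * D ≤ dist (γ s) (γ t) := fun s t hst => by
    rw [← Real.rpow_le_rpow_iff (by positivity) dist_nonneg hp0, hpow]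
    have hst' : (s : ℝ) ≤ t := hst
    have h1 := hX.rpow_dist_triangle hp (γ 0) (γ s) (γ 1)
    have h2 := hX.rpow_dist_triangle hp (γ s) (γ t) (γ 1)
    have h3 := hle 0 s
    have h4 := hle t 1
    rw [Set.Icc.coe_zero, zero_sub, abs_neg, abs_of_nonneg s.2.1] at h3
    rw [Set.Icc.coe_one, abs_sub_comm, abs_of_nonneg (sub_nonneg.2 t.2.2)] at h4
    rw [abs_sub_comm, abs_of_nonneg (sub_nonneg.2 hst')]
    have h5 : D ^ p ≤ _ := h1
    linarith
  refine ⟨continuous_iff_continuousAt.2 fun t => tendsto_iff_dist_tendsto_zero.2 ?_,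
    fun s t => le_antisymm (h s t) ?_⟩
  · refine squeeze_zero (fun _ => dist_nonneg) (fun s => h s t) ?_
    have hcont : Continuous fun s : unitInterval => |(s : ℝ) - t| ^ (1 / p) * D :=
      ((by fun_prop : Continuous fun s : unitInterval => |(s : ℝ) - t|).rpow_const
        fun _ => Or.inr (by positivity)).mul_const D
    have hp1 : p⁻¹ ≠ 0 := by positivity
    simpa [Real.zero_rpow hp1] using hcont.tendsto t
  · rcases le_total s t with hst | hst
    · exact hge s t hst
    · rw [abs_sub_comm, dist_comm (γ s)]
      exact hge t s hst

theorem CompactPMetricClass.isPGeodesicSpace (p : ℝ) [hp : Fact (1 ≤ p)] :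
    IsPGeodesicSpace p (CompactPMetricClass p) := by
  intro A B
  have hp0 : 0 < p := by linarith [hp.out]
  obtain ⟨R, hR, hRc, hRd⟩ := exists_isClosed_optimal hp.out (X := A.cls.Rep) (Y := B.cls.Rep)
  have : CompactSpace R := isCompact_iff_compactSpace.1 hRc.isCompact
  have hfst : Function.Surjective fun z : R => z.1.1 := fun x => by
    obtain ⟨z, hz, rfl⟩ := hR.1.symm ▸ Set.mem_univ x
    exact ⟨⟨z, hz⟩, rfl⟩
  have hsnd : Function.Surjective fun z : R => z.1.2 := fun y => by
    obtain ⟨z, hz, rfl⟩ := hR.2.symm ▸ Set.mem_univ y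
    exact ⟨⟨z, hz⟩, rfl⟩
  have : Nonempty R := ⟨(hfst (Classical.arbitrary _)).choose⟩
  have hcurve : ∀ t : unitInterval, ∃ (C : CompactPMetricClass p) (φ : R → C.cls.Rep),
      Function.Surjective φ ∧ ∀ z w, dist (φ z) (φ w) ^ p
        = (1 - (t : ℝ)) * dist z.1.1 w.1.1 ^ p + t * dist z.1.2 w.1.2 ^ p := by
    intro t
    have ht0 : 0 ≤ (t : ℝ) := t.2.1
    have ht1 : 0 ≤ 1 - (t : ℝ) := sub_nonneg.2 t.2.2
    refine exists_class_of_kernel hp.out (fun z w : R =>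
      (1 - (t : ℝ)) * dist z.1.1 w.1.1 ^ p + t * dist z.1.2 w.1.2 ^ p) (fun z => ?_)
      (fun z w => by positivity) (fun z => by simp [Real.zero_rpow hp0.ne'])
      (fun z w => by simp only [dist_comm]) (fun x y z => ?_)
    · exact (((by fun_prop : Continuous fun w : R => dist w.1.1 z.1.1).rpow_const
        fun _ => Or.inr hp0.le).const_mul _).add
        (((by fun_prop : Continuous fun w : R => dist w.1.2 z.1.2).rpow_const
        fun _ => Or.inr hp0.le).const_mul _)
    · have h1 := mul_le_mul_of_nonneg_left
        (A.isPMetricSpace.rpow_dist_triangle hp.out x.1.1 y.1.1 z.1.1) ht1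
      have h2 := mul_le_mul_of_nonneg_left
        (B.isPMetricSpace.rpow_dist_triangle hp.out x.1.2 y.1.2 z.1.2) ht0
      linarith
  choose γ φ hφ hφd using hcurve
  -- At `t = 0` the kernel is the pulled back `d_A ^ p`, so `R` parametrizes both spaces with equal
  -- distances and `c = 0` is allowed.
  have h0 : γ 0 = A := dist_le_zero.1 (dist_le_of_surjective (hφ 0) hfst le_rfl fun z w => by
    rw [hφd]
    simp [Real.zero_rpow hp0.ne'])
  have h1 : γ 1 = B := dist_le_zero.1 (dist_le_of_surjective (hφ 1) hsnd le_rfl fun z w => by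
    rw [hφd]
    simp [Real.zero_rpow hp0.ne'])
  refine ⟨γ, (isPMetricSpace_self p).isPGeodesic_of_dist_le hp.out fun s t => ?_, h0, h1⟩
  rw [h0, h1]
  refine dist_le_of_surjective (hφ s) (hφ t) (by positivity) fun z w => ?_
  rw [hφd, hφd, Real.mul_rpow (by positivity) dist_nonneg, ← Real.rpow_mul (abs_nonneg _),
    one_div_mul_cancel hp0.ne', Real.rpow_one]
  calc _ = |(s : ℝ) - t| * |dist z.1.1 w.1.1 ^ p - dist z.1.2 w.1.2 ^ p| := by
        rw [← abs_mul, ← abs_neg]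
        congr 1
        ring
    _ ≤ |(s : ℝ) - t| * (2 * dist A B ^ p) :=
        mul_le_mul_of_nonneg_left (hRd _ z.2 _ w.2) (abs_nonneg _)
    _ = 2 * (|(s : ℝ) - t| * dist A B ^ p) := by ring

/-! ### Absence of `q`-geodesics for `q < p` -/

/-- In a `p`-metric space a `q`-geodesic with `q < p` is constant. -/
theorem IsPMetricSpace.eq_of_isPGeodesic {p q : ℝ} (hq : 1 ≤ q) (hqp : q < p) {X : Type*}
    [MetricSpace X] (hX : IsPMetricSpace p X) {γ : unitInterval → X} (hγ : IsPGeodesic q γ) :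
    γ 0 = γ 1 := by
  have hp : 1 ≤ p := hq.trans hqp.le
  by_contra hne
  have hD : 0 < dist (γ 0) (γ 1) ^ p := Real.rpow_pos_of_pos (dist_pos.2 hne) p
  let m : unitInterval := ⟨1 / 2, by norm_num, by norm_num⟩
  have h := hX.rpow_dist_triangle hp (γ 0) (γ m) (γ 1)
  rw [hγ.dist_eq 0 m, hγ.dist_eq m 1] at h
  have e0 : |((0 : unitInterval) : ℝ) - m| = 1 / 2 := by norm_num [m, abs_of_pos]
  have e1 : |(m : ℝ) - (1 : unitInterval)| = 1 / 2 := by norm_num [m, abs_of_pos]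
  rw [e0, e1, Real.mul_rpow (by positivity) dist_nonneg, ← Real.rpow_mul (by norm_num)] at h
  -- Since `p / q > 1`, each half contributes less than half of `D ^ p`, where `D` is the distance
  -- of the endpoints.
  have hlt : ((1 : ℝ) / 2) ^ (1 / q * p) < 1 / 2 := by
    conv_rhs => rw [← Real.rpow_one (1 / 2 : ℝ)]
    refine Real.rpow_lt_rpow_of_exponent_gt (by norm_num) (by norm_num) ?_
    rw [one_div_mul_eq_div, lt_div_iff₀ (by linarith)]
    linarith
  linarith [mul_lt_mul_of_pos_right hlt hD]

theorem CompactPMetricClass.nontrivial (p : ℝ) (hp : 1 ≤ p) :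
    ∃ A B : CompactPMetricClass p, A ≠ B := by
  have hp0 : 0 < p := by linarith
  have hpoint : IsPMetricSpace p Unit := fun x y z => by
    rw [Subsingleton.elim x z, dist_self]
    unfold pSum
    positivity
  -- All distances are 0 or 1, so the inequality holds for every such `p`.
  have hpair : IsPMetricSpace p ({0, 1} : Set ℝ) := by
    have hz : (0 : ℝ) ^ p = 0 := Real.zero_rpow hp0.ne'
    rintro ⟨x, rfl | rfl⟩ ⟨y, rfl | rfl⟩ ⟨z, rfl | rfl⟩ <;>
      simp [pSum, Subtype.dist_eq, hz, hp0.ne', Real.rpow_nonneg]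
  have : CompactSpace ({0, 1} : Set ℝ) :=
    isCompact_iff_compactSpace.1 (Set.toFinite _).isCompact
  have : Nonempty ({0, 1} : Set ℝ) := ⟨⟨0, by simp⟩⟩
  obtain ⟨A, ⟨e⟩⟩ := exists_class_isometryEquiv hpoint
  obtain ⟨B, ⟨f⟩⟩ := exists_class_isometryEquiv hpair
  refine ⟨A, B, ?_⟩
  rintro rfl
  have h := (f.trans e.symm).injective
    (Subsingleton.elim ((f.trans e.symm) ⟨0, by simp⟩) ((f.trans e.symm) ⟨1, by simp⟩))
  simp at h

theorem CompactPMetricClass.not_isPGeodesicSpace (p : ℝ) [hp : Fact (1 ≤ p)] {q : ℝ} (hq : 1 ≤ q)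
    (hqp : q < p) : ¬ IsPGeodesicSpace q (CompactPMetricClass p) := by
  intro h
  obtain ⟨A, B, hAB⟩ := CompactPMetricClass.nontrivial p hp.out
  obtain ⟨γ, hγ, rfl, rfl⟩ := h A B
  exact hAB ((isPMetricSpace_self p).eq_of_isPGeodesic hq hqp hγ)

theorem IsGeodesicSpace.isPGeodesicSpace_one {X : Type*} [MetricSpace X]
    (h : IsGeodesicSpace X) : IsPGeodesicSpace 1 X := by
  intro x y
  obtain ⟨γ, hc, h0, h1, hd⟩ := h x y
  exact ⟨γ, ⟨hc, by simpa using hd⟩, h0, h1⟩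

end PGromovHausdorff

theorem mainTheorem9 (p : ℝ) [Fact (1 ≤ p)] :
    PGromovHausdorff.IsPGeodesicSpace p (PGromovHausdorff.CompactPMetricClass p) ∧
      (∀ q : ℝ, 1 ≤ q → q < p →
        ¬ PGromovHausdorff.IsPGeodesicSpace q (PGromovHausdorff.CompactPMetricClass p)) ∧
      (1 < p → ¬ PGromovHausdorff.IsGeodesicSpace (PGromovHausdorff.CompactPMetricClass p)) := by
  exact ⟨PGromovHausdorff.CompactPMetricClass.isPGeodesicSpace p,
    fun _ hq hqp => PGromovHausdorff.CompactPMetricClass.not_isPGeodesicSpace p hq hqp,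
    fun hp h => PGromovHausdorff.CompactPMetricClass.not_isPGeodesicSpace p le_rfl hp
      h.isPGeodesicSpace_one⟩
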